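/- Let $n \ge 3$ and let $N = \mathbb{H}^n/\Gamma$ be a compact hyperbolic $n$-manifold, where $\Gamma$ is a group of isometries of $\mathbb{H}^n$ acting freely and properly discontinuously. Let $M = T^1N = (T^1\mathbb{H}^n)/\Gamma$ be its unit tangent bundle, equipped with the Sasaki metric, let $X$ be the geodesic vector field on $M$ (the infinitesimal generator of the geodesic flow), let $\widetilde M \to M$ be the universal Riemannian covering (that is, a simply connected smooth covering with the pulled back Riemannian metric), and let $\widetilde X$ be the lift of $X$ to $\widetilde M$. Then for all $\tilde u, \tilde v \in \widetilde M$ there exists an isometry $F$ of $\widetilde M$, i.e. a diffeomorphism $F : \widetilde M \to \widetilde M$ preserving the Riemannian metric, such that $F(\tilde u) = \tilde v$ and $F$ leaves $\widetilde X$ invariant: $dF_a(\widetilde X(a)) = \widetilde X(F(a))$ for every $a \in \widetilde M$. -/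

import Mathlib

open scoped Manifold ContDiff Topology

noncomputable section

/-- The vector space `ℝ × ℝⁿ`, on which the Minkowski form lives. -/
abbrev Mink (n : ℕ) : Type := ℝ × EuclideanSpace ℝ (Fin n)

/-- The Minkowski form `⟪x, y⟫ = -x₀ y₀ + x₁ y₁ + ⋯ + xₙ yₙ`. -/
def mink {n : ℕ} (x y : Mink n) : ℝ := inner ℝ x.2 y.2 - x.1 * y.1

/-- The upper sheet of the hyperboloid, as a subset of Minkowski space. -/
def hyperboloid (n : ℕ) : Set (Mink n) := {x | mink x x = -1 ∧ 0 < x.1}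

/-- Hyperbolic space `ℍⁿ` in the hyperboloid model. Its tangent space at `x` is the
orthogonal complement of `x` for the Minkowski form, and the restriction of the Minkowski form
to these tangent spaces is the Riemannian metric of constant curvature `-1`. -/
abbrev HypSpace (n : ℕ) : Type := hyperboloid n

/-- The unit tangent vectors of `ℍⁿ`: pairs `(x, v)` with `x ∈ ℍⁿ`, `v ∈ T_xℍⁿ = x^⊥`
and `⟪v, v⟫ = 1`. -/
def unitTangentSet (n : ℕ) : Set (Mink n × Mink n) :=
  {z | z.1 ∈ hyperboloid n ∧ mink z.1 z.2 = 0 ∧ mink z.2 z.2 = 1}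

/-- The unit tangent bundle `T¹ℍⁿ`, an embedded submanifold of dimension `2n - 1`. -/
abbrev UnitTangentHyp (n : ℕ) : Type := unitTangentSet n

/-- The isometry group of `ℍⁿ`: the linear automorphisms of Minkowski space that
preserve the Minkowski form and the upper sheet of the hyperboloid, i.e. `O⁺(n, 1)`. -/
def hypIsom (n : ℕ) : Subgroup (Mink n ≃ₗ[ℝ] Mink n) where
  carrier := {A | (∀ x y, mink (A x) (A y) = mink x y) ∧
    ∀ x, A x ∈ hyperboloid n ↔ x ∈ hyperboloid n}
  mul_mem' := by
    rintro A B ⟨hA, hA'⟩ ⟨hB, hB'⟩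
    refine ⟨fun x y => ?_, fun x => ?_⟩
    · rw [LinearEquiv.mul_apply, LinearEquiv.mul_apply, hA, hB]
    · rw [LinearEquiv.mul_apply, hA', hB']
  one_mem' := ⟨fun _ _ => rfl, fun _ => Iff.rfl⟩
  inv_mem' := by
    rintro A ⟨hA, hA'⟩
    have key : ∀ x, A (A⁻¹ x) = x := fun x => A.apply_symm_apply x
    refine ⟨fun x y => ?_, fun x => ?_⟩
    · rw [← hA, key, key]
    · rw [← hA', key]

/-- Isometries act on `ℍⁿ`. -/
instance hypIsomAction (n : ℕ) : MulAction (hypIsom n) (HypSpace n) where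
  smul A x := ⟨A.1 x.1, (A.2.2 x.1).2 x.2⟩
  one_smul _ := rfl
  mul_smul _ _ _ := rfl

/-- Isometries act on `T¹ℍⁿ` through their differentials; as an isometry is the
restriction of a linear map `A`, its differential is `(x, v) ↦ (A x, A v)`. -/
instance hypIsomTangentAction (n : ℕ) : MulAction (hypIsom n) (UnitTangentHyp n) where
  smul A z := ⟨(A.1 z.1.1, A.1 z.1.2), (A.2.2 z.1.1).2 z.2.1,
    (A.2.1 _ _).trans z.2.2.1, (A.2.1 _ _).trans z.2.2.2⟩
  one_smul _ := rfl
  mul_smul _ _ _ := rfl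

/-- The quotient `N = ℍⁿ/Γ` by a group of isometries. -/
abbrev HypQuotient {n : ℕ} (Γ : Subgroup (hypIsom n)) : Type :=
  MulAction.orbitRel.Quotient Γ (HypSpace n)

/-- The unit tangent bundle `M = T¹N = (T¹ℍⁿ)/Γ` of the quotient `N = ℍⁿ/Γ`. -/
abbrev UnitTangentQuotient {n : ℕ} (Γ : Subgroup (hypIsom n)) : Type :=
  MulAction.orbitRel.Quotient Γ (UnitTangentHyp n)

/-- The quotient map `T¹ℍⁿ → (T¹ℍⁿ)/Γ`. -/
def toUnitTangentQuotient {n : ℕ} (Γ : Subgroup (hypIsom n)) (z : UnitTangentHyp n) :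
    UnitTangentQuotient Γ :=
  Quotient.mk _ z

/-- The orthogonal projection of Minkowski space onto `T_xℍⁿ = x^⊥`, for `x ∈ ℍⁿ`. For a
vector field `w(t)` tangent to `ℍⁿ` along a curve `x(t)` in `ℍⁿ`, the Levi-Civita covariant
derivative is `hypProj x(t) w'(t)`. -/
def hypProj {n : ℕ} (x w : Mink n) : Mink n := w + mink w x • x

/-- The Sasaki metric of `T¹ℍⁿ` at the point `z = (x, v)`. A tangent vector
`ξ = (x'(0), v'(0))` has horizontal part `x'(0)` and vertical part the covariant derivative
of `v` along `x` at time `0`. -/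
def sasaki {n : ℕ} (z ξ η : Mink n × Mink n) : ℝ :=
  mink ξ.1 η.1 + mink (hypProj z.1 ξ.2) (hypProj z.1 η.2)

/-- The geodesic flow of `ℍⁿ`: the geodesic with initial unit velocity `(x, v)` is
`t ↦ cosh t • x + sinh t • v`. -/
def hypGeodesicFlow {n : ℕ} (t : ℝ) (z : Mink n × Mink n) : Mink n × Mink n :=
  (Real.cosh t • z.1 + Real.sinh t • z.2, Real.sinh t • z.1 + Real.cosh t • z.2)

/-- The geodesic vector field of `T¹ℍⁿ`, the generator of the geodesic flow. -/
def hypGeodesicField {n : ℕ} (z : Mink n × Mink n) : Mink n × Mink n := (z.2, z.1)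

theorem hypGeodesicFlow_hasDerivAt {n : ℕ} (z : Mink n × Mink n) (t : ℝ) :
    HasDerivAt (fun τ => hypGeodesicFlow τ z) (hypGeodesicField (hypGeodesicFlow t z)) t := by
  have h1 := ((Real.hasDerivAt_cosh t).smul_const z.1).add
    ((Real.hasDerivAt_sinh t).smul_const z.2)
  have h2 := ((Real.hasDerivAt_sinh t).smul_const z.1).add
    ((Real.hasDerivAt_cosh t).smul_const z.2)
  exact h1.prodMk h2

/-- Along the flow the velocity is parallel, so that the flow lines project to geodesics. -/
theorem hypGeodesicField_horizontal {n : ℕ} (z : UnitTangentHyp n) :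
    hypProj z.1.1 (hypGeodesicField z.1).2 = 0 := by
  have h : mink z.1.1 z.1.1 = -1 := z.2.1.1
  simp [hypProj, hypGeodesicField, h]

section Covering

variable {n d : ℕ} {Γ : Subgroup (hypIsom n)} {Mt : Type*} [TopologicalSpace Mt]

/-- `s` is a smooth lift to `T¹ℍⁿ` of the map `p : M̃ → (T¹ℍⁿ)/Γ` over the open set `U`. -/
structure IsSmoothLift (d : ℕ) [ChartedSpace (EuclideanSpace ℝ (Fin d)) Mt]
    (p : Mt → UnitTangentQuotient Γ) (U : Set Mt)
    (s : Mt → Mink n × Mink n) : Prop where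
  isOpen : IsOpen U
  contMDiffOn : ContMDiffOn (𝓡 d) 𝓘(ℝ, Mink n × Mink n) ∞ s U
  lifts : ∀ a ∈ U, ∃ z : UnitTangentHyp n, z.1 = s a ∧ toUnitTangentQuotient Γ z = p a

/-- The differential of a map `s : M̃ → ℝ^{n+1} × ℝ^{n+1}`. -/
def liftDeriv [ChartedSpace (EuclideanSpace ℝ (Fin d)) Mt]
    (s : Mt → Mink n × Mink n) (a : Mt) (ξ : TangentSpace (𝓡 d) a) :
    Mink n × Mink n :=
  mfderiv (𝓡 d) 𝓘(ℝ, Mink n × Mink n) s a ξ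

/-- `p : M̃ → (T¹ℍⁿ)/Γ` is a smooth covering map. The smooth structure of `(T¹ℍⁿ)/Γ` is the one
for which `T¹ℍⁿ → (T¹ℍⁿ)/Γ` is a local diffeomorphism, so that `p` is a local diffeomorphism if
and only if it lifts, near every point, to a smooth immersion into `T¹ℍⁿ`. -/
structure IsSmoothCovering (d : ℕ) [ChartedSpace (EuclideanSpace ℝ (Fin d)) Mt]
    (p : Mt → UnitTangentQuotient Γ) : Prop where
  isCoveringMap : IsCoveringMap p
  exists_lift : ∀ a, ∃ U s, a ∈ U ∧ IsSmoothLift d p U s ∧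
    Function.Injective (liftDeriv (d := d) s a)

/-- The Riemannian metric `g` on `M̃` is the pullback under `p` of the Sasaki metric of
`(T¹ℍⁿ)/Γ`, i.e. `p` is a local isometry. -/
def IsLocalIsometry [ChartedSpace (EuclideanSpace ℝ (Fin d)) Mt]
    (p : Mt → UnitTangentQuotient Γ) [IsManifold (𝓡 d) ∞ Mt]
    (g : Bundle.ContMDiffRiemannianMetric (𝓡 d) ∞ (EuclideanSpace ℝ (Fin d))
      (fun a : Mt => TangentSpace (𝓡 d) a)) : Prop :=
  ∀ U s, IsSmoothLift d p U s → ∀ a ∈ U, ∀ ξ η : TangentSpace (𝓡 d) a,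
    g.inner a ξ η = sasaki (s a) (liftDeriv s a ξ) (liftDeriv s a η)

/-- The vector field `X` on `M̃` is the lift under `p` of the geodesic vector field of
`(T¹ℍⁿ)/Γ`. -/
def IsGeodesicFieldLift [ChartedSpace (EuclideanSpace ℝ (Fin d)) Mt]
    (p : Mt → UnitTangentQuotient Γ)
    (X : (a : Mt) → TangentSpace (𝓡 d) a) : Prop :=
  ∀ U s, IsSmoothLift d p U s → ∀ a ∈ U, liftDeriv s a (X a) = hypGeodesicField (s a)

end Covering

end

/-! The group `hypIsom n` acts transitively on `T¹ℍⁿ` and preserves both the Sasaki metric and the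
geodesic field, so it remains to carry one isometry `A` over to `M̃`. Since `M̃` is simply
connected, `p` lifts through the covering `π : T¹ℍⁿ → M` to a map `f`, which is an immersion, pulls
the Sasaki metric back to `g` and sends `X` to the geodesic field. Choose `A` with `A • f u = f v`
(`MulAction.IsPretransitive` instance, by reflections) and lift it to a homeomorphism `F` with `f ∘
F = A ∘ f` (`IsCoveringMap.exists_homeomorph_lift`). There is no need to know that `f` is a
diffeomorphism: `π ∘ f` being a covering already gives `f` the lifting property. As `f` is an
immersion, `F` is smooth (`ContMDiffAt.of_comp_immersion`), and differentiating `f ∘ F = A ∘ f`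
gives both invariance claims. -/

noncomputable section

/-! ### Minkowski geometry, reflections and transitivity -/

section Minkowski

variable {n : ℕ}

theorem mink_comm (x y : Mink n) : mink x y = mink y x := by
  simp only [mink, real_inner_comm, mul_comm]

theorem mink_add_left (x y z : Mink n) : mink (x + y) z = mink x z + mink y z := by
  simp only [mink, Prod.fst_add, Prod.snd_add, inner_add_left]; ring

theorem mink_smul_left (c : ℝ) (x z : Mink n) : mink (c • x) z = c * mink x z := by
  simp only [mink, Prod.smul_fst, Prod.smul_snd, real_inner_smul_left, smul_eq_mul]; ring

theorem mink_sub_left (x y z : Mink n) : mink (x - y) z = mink x z - mink y z := by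
  simp only [mink, Prod.fst_sub, Prod.snd_sub, inner_sub_left]; ring

theorem mink_neg_left (x z : Mink n) : mink (-x) z = -mink x z := by
  simp only [mink, Prod.fst_neg, Prod.snd_neg, inner_neg_left]; ring

theorem mink_add_right (x y z : Mink n) : mink z (x + y) = mink z x + mink z y := by
  simp only [mink_comm z, mink_add_left]

theorem mink_smul_right (c : ℝ) (x z : Mink n) : mink z (c • x) = c * mink z x := by
  simp only [mink_comm z, mink_smul_left]

theorem mink_sub_right (x y z : Mink n) : mink z (x - y) = mink z x - mink z y := by
  simp only [mink_comm z, mink_sub_left]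

theorem mink_neg_right (x z : Mink n) : mink z (-x) = -mink z x := by
  simp only [mink_comm z, mink_neg_left]

theorem continuous_mink {T : Type*} [TopologicalSpace T] {f g : T → Mink n}
    (hf : Continuous f) (hg : Continuous g) : Continuous fun t => mink (f t) (g t) := by
  unfold mink
  fun_prop

/-- The Minkowski form is positive definite on the tangent spaces of the hyperboloid. -/
theorem mink_self_pos_of_orthogonal {x w : Mink n} (hx : x ∈ hyperboloid n)
    (hw : mink x w = 0) (h0 : w ≠ 0) : 0 < mink w w := by
  obtain ⟨hx1, hx0⟩ := hx
  simp only [mink, real_inner_self_eq_norm_sq] at *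
  have hcs := abs_real_inner_le_norm x.2 w.2
  have h1 : (x.1 * w.1) ^ 2 ≤ (‖x.2‖ * ‖w.2‖) ^ 2 := by
    rw [← sub_eq_zero.1 hw, ← sq_abs (inner ℝ x.2 w.2)]
    exact pow_le_pow_left₀ (abs_nonneg _) hcs 2
  -- Substituting `‖x.2‖² = x.1² - 1` in Cauchy–Schwarz bounds `mink w w` from below.
  have h2 : ‖w.2‖ ^ 2 ≤ x.1 ^ 2 * (‖w.2‖ ^ 2 - w.1 * w.1) := by
    have : ‖x.2‖ ^ 2 = x.1 ^ 2 - 1 := by linarith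
    rw [mul_pow, mul_pow, this] at h1
    linarith
  have hw2 : w.2 ≠ 0 := by
    intro h
    rw [h, inner_zero_right, zero_sub, neg_eq_zero, mul_eq_zero] at hw
    exact h0 (Prod.ext (hw.resolve_left hx0.ne') h)
  have h3 : 0 < ‖w.2‖ ^ 2 := by positivity
  exact pos_of_mul_pos_right (h3.trans_le h2) (by positivity)

/-- Two vectors of the same sheet of the hyperboloid have negative Minkowski product. -/
theorem mink_neg_of_mem_hyperboloid {x y : Mink n} (hx : x ∈ hyperboloid n)
    (hy : y ∈ hyperboloid n) : mink x y < 0 := by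
  obtain ⟨hx1, hx0⟩ := hx
  obtain ⟨hy1, hy0⟩ := hy
  simp only [mink, real_inner_self_eq_norm_sq] at *
  have hcs := real_inner_le_norm x.2 y.2
  have hx2 : ‖x.2‖ < x.1 := by
    apply lt_of_pow_lt_pow_left₀ 2 hx0.le; linarith
  have hy2 : ‖y.2‖ < y.1 := by
    apply lt_of_pow_lt_pow_left₀ 2 hy0.le; linarith
  have := mul_lt_mul'' hx2 hy2 (norm_nonneg _) (norm_nonneg _)
  linarith

/-- The difference of two distinct points of the hyperboloid is spacelike. -/
theorem mink_sub_self_pos {x y : Mink n} (hx : x ∈ hyperboloid n)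
    (hy : y ∈ hyperboloid n) (hxy : x ≠ y) : 0 < mink (x - y) (x - y) := by
  have hneg := mink_neg_of_mem_hyperboloid hx hy
  -- With `c = mink x y < 0`, the tangential part of `y` at `x` has square `c² - 1`. It is positive,
  -- so `c < -1`, while `x - y` has square `-2 - 2c`.
  have hw : mink x (y + mink x y • x) = 0 := by
    rw [mink_add_right, mink_smul_right, hx.1]; ring
  have hne : y + mink x y • x ≠ 0 := by
    intro h
    have h1 := congrArg (mink y) h
    rw [mink_add_right, mink_smul_right, hy.1, mink_comm y x] at h1
    have h0 : mink y (0 : Mink n) = 0 := by simp [mink]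
    rw [h0] at h1
    have h2 : mink x y = -1 := by nlinarith
    rw [h2, neg_one_smul, add_neg_eq_zero] at h
    exact hxy h.symm
  have hpos := mink_self_pos_of_orthogonal hx hw hne
  simp only [mink_add_right, mink_smul_right, mink_add_left, mink_smul_left, hx.1, hy.1,
    mink_comm y x] at hpos
  simp only [mink_sub_right, mink_sub_left, hx.1, hy.1, mink_comm y x]
  nlinarith

/-- The reflection of Minkowski space in the hyperplane orthogonal to `r`. -/
def minkReflection (r : Mink n) (hr : mink r r ≠ 0) : Mink n ≃ₗ[ℝ] Mink n :=
  LinearEquiv.ofInvolutive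
    { toFun := fun z => z - (2 * mink z r / mink r r) • r
      map_add' := fun x y => by
        rw [mink_add_left, mul_add, add_div, add_smul]; abel
      map_smul' := fun c x => by
        rw [mink_smul_left, RingHom.id_apply, smul_sub, smul_smul]; congr 2; ring }
    (fun z => by
      change (z - (2 * mink z r / mink r r) • r) -
        (2 * mink (z - (2 * mink z r / mink r r) • r) r / mink r r) • r = z
      rw [mink_sub_left, mink_smul_left, sub_sub, ← add_smul, sub_eq_self]
      convert zero_smul ℝ r using 2
      field_simp
      ring)

theorem minkReflection_apply (r : Mink n) (hr : mink r r ≠ 0) (z : Mink n) :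
    minkReflection r hr z = z - (2 * mink z r / mink r r) • r := rfl

theorem minkReflection_involutive (r : Mink n) (hr : mink r r ≠ 0) (z : Mink n) :
    minkReflection r hr (minkReflection r hr z) = z :=
  (minkReflection r hr).apply_symm_apply z

theorem mink_minkReflection (r : Mink n) (hr : mink r r ≠ 0) (x y : Mink n) :
    mink (minkReflection r hr x) (minkReflection r hr y) = mink x y := by
  simp only [minkReflection_apply, mink_sub_left, mink_sub_right, mink_smul_left,
    mink_smul_right, mink_comm r y]
  field_simp
  ring

/-- Only a change of sheet has to be excluded. Otherwise `x` and minus its image would share a sheet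
and have negative product, but that product is `1 + 2⟪x, r⟫² / ⟪r, r⟫`. -/
theorem minkReflection_mem_hyperboloid {r : Mink n} (hr : 0 < mink r r) {x : Mink n}
    (hx : x ∈ hyperboloid n) : minkReflection r hr.ne' x ∈ hyperboloid n := by
  have h1 : mink (minkReflection r hr.ne' x) (minkReflection r hr.ne' x) = -1 := by
    rw [mink_minkReflection, hx.1]
  refine ⟨h1, ?_⟩
  by_contra! hle
  have hlt : (minkReflection r hr.ne' x).1 < 0 := by
    refine lt_of_le_of_ne hle fun h => ?_
    rw [mink, h, real_inner_self_eq_norm_sq] at h1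
    nlinarith [sq_nonneg ‖(minkReflection r hr.ne' x).2‖]
  have hmem : -minkReflection r hr.ne' x ∈ hyperboloid n :=
    ⟨by rw [mink_neg_left, mink_neg_right, neg_neg, h1], by simpa using hlt⟩
  have h2 := mink_neg_of_mem_hyperboloid hx hmem
  rw [mink_neg_right, minkReflection_apply, mink_sub_right, mink_smul_right, hx.1] at h2
  have h3 : 0 ≤ 2 * mink x r / mink r r * mink x r := by
    rw [show 2 * mink x r / mink r r * mink x r = 2 * mink x r ^ 2 / mink r r by ring]
    positivity
  linarith

/-- The reflection in a spacelike vector is an isometry of hyperbolic space. -/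
def hypReflection (r : Mink n) (hr : 0 < mink r r) : hypIsom n :=
  ⟨minkReflection r hr.ne', mink_minkReflection r hr.ne', fun x =>
    ⟨fun h => minkReflection_involutive r hr.ne' x ▸ minkReflection_mem_hyperboloid hr h,
      minkReflection_mem_hyperboloid hr⟩⟩

theorem minkReflection_sub {x y : Mink n} (hxy : mink x x = mink y y)
    (hr : mink (x - y) (x - y) ≠ 0) : minkReflection (x - y) hr x = y := by
  have h : 2 * mink x (x - y) / mink (x - y) (x - y) = 1 := by
    rw [div_eq_one_iff_eq hr]
    simp only [mink_sub_left, mink_sub_right, mink_comm y x, hxy]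
    ring
  rw [minkReflection_apply, h, one_smul, sub_sub_cancel]

theorem minkReflection_of_orthogonal {r x : Mink n} (hr : mink r r ≠ 0) (hx : mink x r = 0) :
    minkReflection r hr x = x := by
  rw [minkReflection_apply, hx, mul_zero, zero_div, zero_smul, sub_zero]

theorem exists_hypIsom_apply_eq {x y : Mink n} (hx : x ∈ hyperboloid n)
    (hy : y ∈ hyperboloid n) : ∃ A : hypIsom n, A.1 x = y := by
  by_cases hxy : x = y
  · exact ⟨1, hxy⟩
  · exact ⟨hypReflection (x - y) (mink_sub_self_pos hx hy hxy),
      minkReflection_sub (hx.1.trans hy.1.symm) (mink_sub_self_pos hx hy hxy).ne'⟩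

/-- The vector `v - w` is tangent at `x`, hence spacelike, and its reflection swaps `v` and `w`
while fixing `x`. -/
theorem exists_hypIsom_apply_eq_of_orthogonal {x v w : Mink n} (hx : x ∈ hyperboloid n)
    (hxv : mink x v = 0) (hxw : mink x w = 0) (hvw : mink v v = mink w w) :
    ∃ A : hypIsom n, A.1 x = x ∧ A.1 v = w := by
  by_cases h : v = w
  · exact ⟨1, rfl, h⟩
  · have h0 : mink x (v - w) = 0 := by rw [mink_sub_right, hxv, hxw, sub_zero]
    have hr := mink_self_pos_of_orthogonal hx h0 (sub_ne_zero.2 h)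
    exact ⟨hypReflection (v - w) hr, minkReflection_of_orthogonal hr.ne' h0,
      minkReflection_sub hvw hr.ne'⟩

/-- The isometry group acts transitively on the unit tangent bundle of hyperbolic space. -/
instance : MulAction.IsPretransitive (hypIsom n) (UnitTangentHyp n) where
  exists_smul_eq := by
    intro z w
    obtain ⟨A, hA⟩ := exists_hypIsom_apply_eq z.2.1 w.2.1
    have hA2 := (A • z).2
    have h1 : (A • z).1.1 = w.1.1 := hA
    obtain ⟨B, hB, hB'⟩ := exists_hypIsom_apply_eq_of_orthogonal (v := (A • z).1.2)
      (w := w.1.2) w.2.1 (h1 ▸ hA2.2.1) w.2.2.1 (hA2.2.2.trans w.2.2.2.symm)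
    refine ⟨B * A, ?_⟩
    rw [mul_smul]
    exact Subtype.ext (Prod.ext ((congrArg B.1 h1).trans hB) hB')

end Minkowski

/-! ### The action on `T¹ℍⁿ` and its quotient covering -/

section Action

variable {n : ℕ}

/-- The linear extension of the differential of an isometry to pairs of Minkowski vectors. -/
def hypIsomProd (A : hypIsom n) : (Mink n × Mink n) →L[ℝ] (Mink n × Mink n) :=
  (LinearMap.toContinuousLinearMap (A.1 : Mink n →ₗ[ℝ] Mink n)).prodMap
    (LinearMap.toContinuousLinearMap (A.1 : Mink n →ₗ[ℝ] Mink n))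

theorem hypIsomProd_apply (A : hypIsom n) (z : Mink n × Mink n) :
    hypIsomProd A z = (A.1 z.1, A.1 z.2) := rfl

theorem coe_smul_unitTangentHyp (A : hypIsom n) (z : UnitTangentHyp n) :
    (A • z).1 = hypIsomProd A z.1 := rfl

theorem hypIsomProd_injective (A : hypIsom n) : Function.Injective (hypIsomProd A) := by
  intro z w h
  exact Prod.ext (A.1.injective (congrArg Prod.fst h)) (A.1.injective (congrArg Prod.snd h))

theorem sasaki_hypIsomProd (A : hypIsom n) (z ξ η : Mink n × Mink n) :
    sasaki (hypIsomProd A z) (hypIsomProd A ξ) (hypIsomProd A η) = sasaki z ξ η := by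
  have h : ∀ x w : Mink n, hypProj (A.1 x) (A.1 w) = A.1 (hypProj x w) := fun x w => by
    simp only [hypProj, map_add, map_smul, A.2.1]
  simp only [sasaki, hypIsomProd_apply, h, A.2.1]

theorem hypGeodesicField_hypIsomProd (A : hypIsom n) (z : Mink n × Mink n) :
    hypGeodesicField (hypIsomProd A z) = hypIsomProd A (hypGeodesicField z) := rfl

instance : ContinuousConstSMul (hypIsom n) (UnitTangentHyp n) where
  continuous_const_smul A :=
    ((hypIsomProd A).continuous.comp continuous_subtype_val).subtype_mk _

/-- Used by the criterion that turns a free, properly discontinuous action into a covering. -/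
instance : LocallyCompactSpace (UnitTangentHyp n) := by
  have h : unitTangentSet n = {z | 0 < z.1.1} ∩ {z | mink z.1 z.1 = -1 ∧ mink z.1 z.2 = 0 ∧
      mink z.2 z.2 = 1} := by
    ext z
    simp only [unitTangentSet, hyperboloid, Set.mem_ofPred_eq, Set.mem_inter_iff]
    tauto
  have ho : IsOpen {z : Mink n × Mink n | 0 < z.1.1} :=
    isOpen_lt continuous_const (by fun_prop)
  have hc : IsClosed {z : Mink n × Mink n | mink z.1 z.1 = -1 ∧ mink z.1 z.2 = 0 ∧
      mink z.2 z.2 = 1} :=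
    (isClosed_eq (continuous_mink continuous_fst continuous_fst) continuous_const).inter
      ((isClosed_eq (continuous_mink continuous_fst continuous_snd) continuous_const).inter
        (isClosed_eq (continuous_mink continuous_snd continuous_snd) continuous_const))
  have : IsLocallyClosed (unitTangentSet n) := h ▸ ho.isLocallyClosed.inter hc.isLocallyClosed
  exact this.locallyCompactSpace

/-- The foot point of a unit tangent vector. -/
def footPoint (z : UnitTangentHyp n) : HypSpace n := ⟨z.1.1, z.2.1⟩

theorem continuous_footPoint : Continuous (footPoint (n := n)) :=
  (continuous_fst.comp continuous_subtype_val).subtype_mk _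

variable (Γ : Subgroup (hypIsom n))

theorem footPoint_smul (γ : Γ) (z : UnitTangentHyp n) : footPoint (γ • z) = γ • footPoint z := rfl

/-- The foot point map is continuous and equivariant: if `γK` meets `L`, the same holds for their
compact images in `ℍⁿ`. -/
theorem properlyDiscontinuousSMul_unitTangentHyp [ProperlyDiscontinuousSMul Γ (HypSpace n)] :
    ProperlyDiscontinuousSMul Γ (UnitTangentHyp n) where
  finite_disjoint_inter_image {K L} hK hL := by
    refine (ProperlyDiscontinuousSMul.finite_disjoint_inter_image (Γ := Γ)
      (hK.image continuous_footPoint) (hL.image continuous_footPoint)).subset ?_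
    rintro γ ⟨-, ⟨z, hz, rfl⟩, hL'⟩
    exact ⟨footPoint (γ • z), ⟨footPoint z, ⟨z, hz, rfl⟩, rfl⟩, ⟨γ • z, hL', rfl⟩⟩

/-- A free and properly discontinuous action on hyperbolic space induces a covering map from
the unit tangent bundle to its quotient. -/
theorem isQuotientCoveringMap_toUnitTangentQuotient
    (hfree : ∀ (γ : Γ) (x : HypSpace n), γ • x = x → γ = 1)
    [ProperlyDiscontinuousSMul Γ (HypSpace n)] :
    IsQuotientCoveringMap (toUnitTangentQuotient Γ) Γ := by
  have := properlyDiscontinuousSMul_unitTangentHyp Γ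
  have : IsCancelSMul Γ (UnitTangentHyp n) :=
    isCancelSMul_iff_eq_one_of_smul_eq.2 fun γ z h =>
      hfree γ (footPoint z) ((footPoint_smul Γ γ z).symm.trans (congrArg footPoint h))
  have : ContinuousConstSMul Γ (UnitTangentHyp n) := ⟨fun γ => continuous_const_smul γ.1⟩
  exact isQuotientCoveringMap_quotientMk_of_properlyDiscontinuousSMul

end Action

/-! ### Lifting maps through a factor of a covering -/

section Lifting

open unitInterval

variable {E Y X A : Type*} [TopologicalSpace E] [TopologicalSpace Y] [TopologicalSpace X]
  [TopologicalSpace A]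

/-- A separated local homeomorphism with the path lifting property has the lifting property
for maps from simply connected, locally path connected spaces. -/
theorem IsLocalHomeomorph.existsUnique_continuousMap_lifts_of_path_lifts {p : E → X}
    (homeo : IsLocalHomeomorph p) (sep : IsSeparatedMap p)
    (path : ∀ (γ : C(I, X)) (e : E), γ 0 = p e → ∃ Γ : C(I, E), p ∘ Γ = γ ∧ Γ 0 = e)
    [SimplyConnectedSpace A] [LocallyPathConnectedSpace A]
    (f : C(A, X)) (a₀ : A) (e₀ : E) (he : p e₀ = f a₀) :
    ∃! F : C(A, E), F a₀ = e₀ ∧ p ∘ F = f := by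
  refine homeo.existsUnique_continuousMap_lifts f a₀ e₀ he (fun γ hγ => ?_)
    fun γ γ' Γ Γ' γ_0 γ'_0 Γ_0 Γ'_0 hΓ hΓ' h1 => ?_
  · obtain ⟨Γ, h, h'⟩ := path (f.comp γ) e₀ (by simp [hγ, he])
    exact ⟨Γ, h', h⟩
  · let q : Path a₀ (γ 1) := ⟨γ, γ_0, rfl⟩
    let q' : Path a₀ (γ 1) := ⟨γ', γ'_0, h1.symm⟩
    obtain ⟨H⟩ := ContinuousMap.HomotopicRel.comp_continuousMap
      (SimplyConnectedSpace.paths_homotopic q q') f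
    have hH0 : ∀ t, H (t, 0) = p e₀ := fun t => by
      rw [H.eq_fst t (Or.inl rfl), he]
      exact congrArg f γ_0
    -- Lift every path of the homotopy from `e₀`; by monodromy the lifts share their endpoint, and
    -- `Γ`, `Γ'` are the lifts at times `0` and `1`.
    choose G hG hG0 using fun t : I => path ⟨fun s => H (t, s), by fun_prop⟩ e₀ (hH0 t)
    have key := homeo.monodromy_theorem sep H G (fun t s => congrFun (hG t) s)
      (fun t => (hG0 t).trans (hG0 0).symm) 1
    have e0 : (Γ : I → E) = G 0 := by
      refine sep.eq_of_comp_eq homeo.isLocallyInjective Γ.continuous (G 0).continuous ?_ 0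
        (Γ_0.trans (hG0 0).symm)
      rw [hΓ, hG 0]
      funext s
      exact (H.apply_zero s).symm
    have e1 : (Γ' : I → E) = G 1 := by
      refine sep.eq_of_comp_eq homeo.isLocallyInjective Γ'.continuous (G 1).continuous ?_ 0
        (Γ'_0.trans (hG0 1).symm)
      rw [hΓ', hG 1]
      funext s
      exact (H.apply_one s).symm
    rw [e0, e1, key]

/-- A lift of a covering map through a covering map has the lifting property for maps from
simply connected, locally path connected spaces. -/
theorem IsCoveringMap.existsUnique_continuousMap_lifts_of_comp {π : Y → X} {f : E → Y}
    (hπ : IsCoveringMap π) (hf : Continuous f) (hp : IsCoveringMap (π ∘ f))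
    [SimplyConnectedSpace A] [LocallyPathConnectedSpace A]
    (g : C(A, Y)) (a₀ : A) (e₀ : E) (he : f e₀ = g a₀) :
    ∃! F : C(A, E), F a₀ = e₀ ∧ f ∘ F = g := by
  have homeo : IsLocalHomeomorph f := hp.isLocalHomeomorph.of_comp hπ.isLocalHomeomorph hf
  have sep : IsSeparatedMap f := fun a b hab hne => hp.isSeparatedMap a b (congrArg π hab) hne
  refine homeo.existsUnique_continuousMap_lifts_of_path_lifts sep (fun γ e hγ => ?_) g a₀ e₀ he
  -- Lift `π ∘ γ` all the way to `E`; uniqueness of lifts through `π` then forces `f ∘ G = γ`.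
  obtain ⟨G, hG, hG0⟩ := hp.exists_path_lifts (ContinuousMap.comp ⟨π, hπ.continuous⟩ γ) e
    (congrArg π hγ)
  refine ⟨G, hπ.eq_of_comp_eq (hf.comp G.continuous) γ.continuous hG 0 ?_, hG0⟩
  rw [Function.comp_apply, hG0, hγ]

/-- If a simply connected, locally path connected space `E` is mapped to `Y` by a lift `f` of a
covering map, then every self-homeomorphism of `Y` lifts to a self-homeomorphism of `E`. -/
theorem IsCoveringMap.exists_homeomorph_lift {π : Y → X} {f : E → Y}
    (hπ : IsCoveringMap π) (hf : Continuous f) (hp : IsCoveringMap (π ∘ f))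
    [SimplyConnectedSpace E] [LocallyPathConnectedSpace E]
    (h : Y ≃ₜ Y) (u v : E) (huv : h (f u) = f v) :
    ∃ F : E ≃ₜ E, F u = v ∧ ∀ a, f (F a) = h (f a) := by
  obtain ⟨F, ⟨hFu, hF⟩, -⟩ := hπ.existsUnique_continuousMap_lifts_of_comp hf hp
    (⟨fun a => h (f a), by fun_prop⟩ : C(E, Y)) u v huv.symm
  obtain ⟨G, ⟨hGv, hG⟩, -⟩ := hπ.existsUnique_continuousMap_lifts_of_comp hf hp
    (⟨fun a => h.symm (f a), by fun_prop⟩ : C(E, Y)) v u (by simp [← huv])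
  have hF' : ∀ a, f (F a) = h (f a) := fun a => congrFun hF a
  have hG' : ∀ a, f (G a) = h.symm (f a) := fun a => congrFun hG a
  -- A self-map over `f` with a fixed point is the identity, so the lifts of `h` and `h.symm` are
  -- mutually inverse.
  have uniq : ∀ (K : C(E, E)) (a : E), (∀ b, f (K b) = f b) → K a = a → ∀ b, K b = b :=
    fun K a hK ha b => congrFun (hp.eq_of_comp_eq K.continuous continuous_id
      (funext fun b => congrArg π (hK b)) a ha) b
  exact ⟨
    { toFun := F
      invFun := G
      left_inv := uniq (G.comp F) u (fun b => by simp [hF', hG']) (by simp [hFu, hGv])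
      right_inv := uniq (F.comp G) v (fun b => by simp [hF', hG']) (by simp [hFu, hGv])
      continuous_toFun := F.continuous
      continuous_invFun := G.continuous }, hFu, hF'⟩

end Lifting

/-! ### Smoothness through an immersion -/

section Immersion

variable {E V M M' E' H' : Type*} [NormedAddCommGroup E] [NormedSpace ℝ E]
  [FiniteDimensional ℝ E] [NormedAddCommGroup V] [NormedSpace ℝ V] [FiniteDimensional ℝ V]
  [TopologicalSpace M] [ChartedSpace E M] [IsManifold 𝓘(ℝ, E) ∞ M]
  [NormedAddCommGroup E'] [NormedSpace ℝ E'] [TopologicalSpace H'] {J : ModelWithCorners ℝ E' H'}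
  [TopologicalSpace M'] [ChartedSpace H' M']

/-- A smooth map to a vector space with injective derivative at a point has a smooth left inverse
near that point. -/
theorem ContMDiffAt.exists_local_leftInverse {f : M → V} {b : M}
    (hf : ContMDiffAt 𝓘(ℝ, E) 𝓘(ℝ, V) ∞ f b)
    (hinj : Function.Injective (mfderiv 𝓘(ℝ, E) 𝓘(ℝ, V) f b)) :
    ∃ r : V → M, ContMDiffAt 𝓘(ℝ, V) 𝓘(ℝ, E) ∞ r (f b) ∧ ∀ᶠ x in 𝓝 b, r (f x) = x := by
  set φ := extChartAt 𝓘(ℝ, E) b with hφ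
  have hd := (hf.mdifferentiableAt (by simp)).hasMFDerivAt.2
  have hc := (contMDiffAt_iff.1 hf).2
  simp only [writtenInExtChartAt, extChartAt_model_space_eq_id, PartialEquiv.refl_coe,
    Function.id_comp, modelWithCornersSelf_coe, Set.range_id,
    contDiffWithinAt_univ, ← hφ] at hd hc
  set D : E →L[ℝ] V := mfderiv 𝓘(ℝ, E) 𝓘(ℝ, V) f b
  -- Composing with a linear left inverse of the derivative makes the derivative in the chart the
  -- identity, so the inverse function theorem applies.
  obtain ⟨L₀, hL₀⟩ := LinearMap.exists_leftInverse_of_injective (D : E →ₗ[ℝ] V)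
    (LinearMap.ker_eq_bot.2 hinj)
  set L : V →L[ℝ] E := LinearMap.toContinuousLinearMap L₀
  have hLD : L.comp D = ((ContinuousLinearEquiv.refl ℝ E : E ≃L[ℝ] E) : E →L[ℝ] E) := by
    ext x
    exact LinearMap.congr_fun hL₀ x
  have hh : ContDiffAt ℝ ∞ (L ∘ (f ∘ φ.symm)) (φ b) := L.contDiff.contDiffAt.comp _ hc
  have hhd : HasFDerivAt (L ∘ (f ∘ φ.symm))
      ((ContinuousLinearEquiv.refl ℝ E : E ≃L[ℝ] E) : E →L[ℝ] E) (φ b) := by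
    rw [← hLD]
    exact L.hasFDerivAt.comp _ (hasFDerivWithinAt_univ.1 hd)
  have hn : (∞ : WithTop ℕ∞) ≠ 0 := by simp
  let ψ := hh.localInverse hhd hn
  have hhb : (L ∘ (f ∘ φ.symm)) (φ b) = L (f b) := by
    simp [hφ]
  have hψc : ContDiffAt ℝ ∞ ψ (L (f b)) := hhb ▸ hh.to_localInverse hhd hn
  have hψb : ψ (L (f b)) = φ b := hhb ▸ hh.localInverse_apply_image hhd hn
  refine ⟨φ.symm ∘ (ψ ∘ L), ?_, ?_⟩
  · have h1 : ContMDiffAt 𝓘(ℝ, V) 𝓘(ℝ, E) ∞ (ψ ∘ L) (f b) :=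
      (hψc.comp (f b) L.contDiff.contDiffAt).contMDiffAt
    refine ContMDiffAt.comp (f b) (I' := 𝓘(ℝ, E)) ?_ h1
    rw [Function.comp_apply, hψb]
    exact (contMDiffOn_extChartAt_symm b).contMDiffAt
      (extChartAt_target_mem_nhds (I := 𝓘(ℝ, E)) b)
  · have h1 : ∀ᶠ y in 𝓝 (φ b), ψ ((L ∘ (f ∘ φ.symm)) y) = y :=
      (hh.hasStrictFDerivAt' hhd hn).eventually_left_inverse
    have h2 := (continuousAt_extChartAt (I := 𝓘(ℝ, E)) b).eventually h1
    filter_upwards [h2, extChartAt_source_mem_nhds (I := 𝓘(ℝ, E)) b] with x hx hxs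
    have h3 : φ.symm (φ x) = x := φ.left_inv hxs
    simp only [Function.comp_apply, ← hφ, h3] at hx ⊢
    rw [hx, h3]

/-- A continuous map is smooth if its composition with an immersion is. -/
theorem ContMDiffAt.of_comp_immersion {f : M → V} {F : M' → M} {a : M'}
    (hf : ContMDiffAt 𝓘(ℝ, E) 𝓘(ℝ, V) ∞ f (F a))
    (hinj : Function.Injective (mfderiv 𝓘(ℝ, E) 𝓘(ℝ, V) f (F a)))
    (hF : ContinuousAt F a) (hfF : ContMDiffAt J 𝓘(ℝ, V) ∞ (fun x => f (F x)) a) :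
    ContMDiffAt J 𝓘(ℝ, E) ∞ F a := by
  obtain ⟨r, hr, hrf⟩ := hf.exists_local_leftInverse hinj
  refine (ContMDiffAt.comp a (g := r) hr hfF).congr_of_eventuallyEq ?_
  filter_upwards [hF.eventually hrf] with x hx
  exact hx.symm

end Immersion

/-! ### Continuous lifts are immersions -/

section SmoothLift

variable {n d : ℕ} {Γ : Subgroup (hypIsom n)} {Mt : Type*} [TopologicalSpace Mt]
  [ChartedSpace (EuclideanSpace ℝ (Fin d)) Mt] {p : Mt → UnitTangentQuotient Γ}

/-- A continuous lift to `T¹ℍⁿ` of a smooth covering of `(T¹ℍⁿ)/Γ` is a smooth immersion. -/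
theorem IsSmoothCovering.contMDiffAt_lift (hp : IsSmoothCovering d p)
    (hπ : IsQuotientCoveringMap (toUnitTangentQuotient Γ) Γ) {f : Mt → UnitTangentHyp n}
    (hf : Continuous f) (hfp : ∀ a, toUnitTangentQuotient Γ (f a) = p a) (a : Mt) :
    ContMDiffAt (𝓡 d) 𝓘(ℝ, Mink n × Mink n) ∞ (fun b => (f b).1) a ∧
      Function.Injective (liftDeriv (d := d) (fun b => (f b).1) a) := by
  obtain ⟨U, s, haU, hs, hinj⟩ := hp.exists_lift a
  have hU : U ∈ 𝓝 a := hs.isOpen.mem_nhds haU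
  choose t ht htp using fun b : U => hs.lifts b b.2
  have htc : Continuous t := by
    refine Topology.IsInducing.subtypeVal.continuous_iff.2 ?_
    have h := continuousOn_iff_continuous_domRestrict.1 hs.contMDiffOn.continuousOn
    exact h.congr fun b => (ht b).symm
  -- At `a` the two lifts differ by a deck transformation `γ`; since `π` is locally injective, `f =
  -- γ • t` persists near `a`, and `f` inherits the properties of `s`.
  obtain ⟨γ, hγ⟩ := hπ.apply_eq_iff_mem_orbit.1 ((hfp a).trans (htp ⟨a, haU⟩).symm)
  have hopen := hπ.isCoveringMap.isLocalHomeomorph.isLocallyInjective.isOpen_eqLocus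
    (g₁ := fun b : U => f b) (g₂ := fun b => γ.1 • t b)
    (hf.comp continuous_subtype_val) (htc.const_smul γ.1)
    (funext fun b => by
      refine (hfp b).trans ((htp b).symm.trans ?_)
      exact (hπ.map_smul γ).symm)
  have hev : (fun b => (f b).1) =ᶠ[𝓝 a] fun b => hypIsomProd γ.1 (s b) := by
    have h := (hs.isOpen.isOpenMap_subtype_val _ hopen).mem_nhds ⟨⟨a, haU⟩, hγ.symm, rfl⟩
    filter_upwards [h]
    rintro _ ⟨b, hb, rfl⟩
    have hb' : f b = γ.1 • t b := hb
    rw [hb', coe_smul_unitTangentHyp, ht]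
  have hsa : ContMDiffAt (𝓡 d) 𝓘(ℝ, Mink n × Mink n) ∞ s a := hs.contMDiffOn.contMDiffAt hU
  refine ⟨((hypIsomProd γ.1).contMDiff.contMDiffAt.comp a hsa).congr_of_eventuallyEq hev, ?_⟩
  have hder : HasMFDerivAt (𝓡 d) 𝓘(ℝ, Mink n × Mink n) (fun b => hypIsomProd γ.1 (s b)) a
      ((hypIsomProd γ.1).comp (mfderiv (𝓡 d) 𝓘(ℝ, Mink n × Mink n) s a)) :=
    (hypIsomProd γ.1).hasMFDerivAt.comp a (hsa.mdifferentiableAt (by simp)).hasMFDerivAt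
  intro ξ η h
  unfold liftDeriv at h
  rw [hev.mfderiv_eq, hder.mfderiv] at h
  exact hinj (hypIsomProd_injective γ.1 h)

end SmoothLift

end

/-! ### The isometry of `M̃` -/

theorem mainTheorem4 (n : ℕ) (hn : 3 ≤ n)
    -- the compact hyperbolic manifold `N = ℍⁿ/Γ`, with unit tangent bundle `M`
    (Γ : Subgroup (hypIsom n))
    (hfree : ∀ (γ : Γ) (x : HypSpace n), γ • x = x → γ = 1)
    [ProperlyDiscontinuousSMul Γ (HypSpace n)]
    [CompactSpace (HypQuotient Γ)]
    -- the universal Riemannian covering `p : M̃ → M`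
    {Mt : Type*} [TopologicalSpace Mt] [ChartedSpace (EuclideanSpace ℝ (Fin (2 * n - 1))) Mt]
    [IsManifold (𝓡 (2 * n - 1)) ∞ Mt] [SimplyConnectedSpace Mt]
    (p : Mt → UnitTangentQuotient Γ) (hp : IsSmoothCovering (2 * n - 1) p)
    (g : Bundle.ContMDiffRiemannianMetric (𝓡 (2 * n - 1)) ∞
      (EuclideanSpace ℝ (Fin (2 * n - 1))) (fun a : Mt => TangentSpace (𝓡 (2 * n - 1)) a))
    (hg : IsLocalIsometry p g)
    -- the lift of the geodesic vector field
    (X : (a : Mt) → TangentSpace (𝓡 (2 * n - 1)) a) (hX : IsGeodesicFieldLift p X)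
    (u v : Mt) :
    ∃ F : Mt ≃ₘ^∞⟮𝓡 (2 * n - 1), 𝓡 (2 * n - 1)⟯ Mt,
      F u = v ∧
      (∀ (a : Mt) (ξ η : TangentSpace (𝓡 (2 * n - 1)) a),
        g.inner (F a) (mfderiv (𝓡 (2 * n - 1)) (𝓡 (2 * n - 1)) F a ξ)
          (mfderiv (𝓡 (2 * n - 1)) (𝓡 (2 * n - 1)) F a η) = g.inner a ξ η) ∧
      ∀ a : Mt, mfderiv (𝓡 (2 * n - 1)) (𝓡 (2 * n - 1)) F a (X a) = X (F a) := by
  have := ChartedSpace.locallyPathConnectedSpace (EuclideanSpace ℝ (Fin (2 * n - 1))) Mt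
  have hπ := isQuotientCoveringMap_toUnitTangentQuotient Γ hfree
  obtain ⟨z₀, hz₀⟩ := hπ.surjective (p u)
  obtain ⟨f, ⟨-, hf⟩, -⟩ := hπ.isCoveringMap.existsUnique_continuousMap_lifts
    ⟨p, hp.isCoveringMap.continuous⟩ u z₀ hz₀
  have hfp : ∀ a, toUnitTangentQuotient Γ (f a) = p a := fun a => congrFun hf a
  set s : Mt → Mink n × Mink n := fun a => (f a).1 with hs_def
  have hsm := fun a => (hp.contMDiffAt_lift hπ f.continuous hfp a).1
  have hinj := fun a => (hp.contMDiffAt_lift hπ f.continuous hfp a).2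
  -- A single global lift, so `hg` and `hX` can be compared at `a` and `F a` through the same `s`.
  have hs : IsSmoothLift (2 * n - 1) p Set.univ s :=
    ⟨isOpen_univ, fun a _ => (hsm a).contMDiffWithinAt, fun a _ => ⟨f a, rfl, hfp a⟩⟩
  obtain ⟨A, hA⟩ := MulAction.exists_smul_eq (hypIsom n) (f u) (f v)
  have hcov : IsCoveringMap (toUnitTangentQuotient Γ ∘ f) := hf ▸ hp.isCoveringMap
  obtain ⟨F, hFu, hF⟩ := hπ.isCoveringMap.exists_homeomorph_lift f.continuous hcov
    (Homeomorph.smul A) u v hA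
  have hsF : ∀ a, s (F a) = hypIsomProd A (s a) := fun a => congrArg Subtype.val (hF a)
  have hsF' : ∀ a, s (F.symm a) = hypIsomProd A⁻¹ (s a) := fun a => by
    have h : f (F.symm a) = A⁻¹ • f a := by
      rw [eq_inv_smul_iff]
      exact (hF _).symm.trans (congrArg f (F.apply_symm_apply a))
    exact congrArg Subtype.val h
  have smooth : ∀ (G : Mt → Mt) (B : hypIsom n), Continuous G →
      (∀ a, s (G a) = hypIsomProd B (s a)) →
      ContMDiff (𝓡 (2 * n - 1)) (𝓡 (2 * n - 1)) ∞ G := fun G B hG hGB a =>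
    ContMDiffAt.of_comp_immersion (hsm (G a)) (hinj (G a)) hG.continuousAt <| by
      have hsG : (fun b => s (G b)) = fun b => hypIsomProd B (s b) := funext hGB
      exact hsG ▸ (hypIsomProd B).contMDiff.contMDiffAt.comp a (hsm a)
  have hFsm := smooth F A F.continuous hsF
  -- The chain rule for `s ∘ F = hypIsomProd A ∘ s`.
  have hd : ∀ a (ξ : TangentSpace (𝓡 (2 * n - 1)) a),
      liftDeriv s (F a) (mfderiv (𝓡 (2 * n - 1)) (𝓡 (2 * n - 1)) F a ξ) =
        hypIsomProd A (liftDeriv s a ξ) := fun a ξ => by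
    have hsd := fun b => ((hsm b).mdifferentiableAt (by simp)).hasMFDerivAt
    have h1 := (hsd (F a)).comp a ((hFsm a).mdifferentiableAt (by simp)).hasMFDerivAt
    have h2 := (hypIsomProd A).hasMFDerivAt.comp a (hsd a)
    have h3 : s ∘ F = hypIsomProd A ∘ s := funext hsF
    exact DFunLike.congr_fun (hasMFDerivAt_unique h1 (h3 ▸ h2)) ξ
  -- Equality of the vector fields may be tested after the injective differential of `s`.
  refine ⟨⟨F.toEquiv, hFsm, smooth F.symm A⁻¹ F.symm.continuous hsF'⟩, hFu,
    fun a ξ η => ?_, fun a => hinj (F a) ?_⟩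
  · refine (hg _ s hs (F a) trivial _ _).trans ?_
    refine Eq.trans ?_ (hg _ s hs a trivial ξ η).symm
    refine Eq.trans ?_ (sasaki_hypIsomProd A _ _ _)
    rw [← hsF a, ← hd a ξ, ← hd a η]
    rfl
  · refine (hd a (X a)).trans ?_
    rw [hX _ s hs a trivial, ← hypGeodesicField_hypIsomProd, ← hsF a]
    exact (hX _ s hs (F a) trivial).symm
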